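/- Let $F$ be an algebraically closed field of characteristic zero, let $L$ be a finite-dimensional simple Lie algebra over $F$, and let $L=\bigoplus_{g\in G}L_g$ be a grading by an abelian group $G$ (written additively), so that $[L_g,L_h]\subseteq L_{g+h}$ for all $g,h\in G$, where $G$ is generated by the support $\{g\in G: L_g\neq 0\}$. Assume that the grading is fine, i.e. whenever $L=\bigoplus_{h\in H}M_h$ is a grading by an abelian group $H$ generated by its support such that each nonzero $L_g$ is a direct sum of some of the components $M_h$, the two gradings have the same nonzero homogeneous components. Then every homogeneous element $x\in L_g$, $g\in G$, is either semisimple or nilpotent, i.e. $\operatorname{ad}x$ is a semisimple endomorphism of $L$ or a nilpotent one. Moreover, $L_0$ is an abelian toral subalgebra of $L$ (toral: $\operatorname{ad}x$ is semisimple for every $x\in L_0$), and its dimension equals the dimension of the quasitorus producing the grading, that is, of the algebraic group of all automorphisms of $L$ that act as a scalar on each homogeneous component. -/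

import Mathlib

universe v

namespace LieGrading

section Gradings

variable {F L G : Type*} [Field F] [LieRing L] [LieAlgebra F L]

/-- The grading group is generated by the support `{g | ℒ g ≠ 0}` of the grading. -/
def GeneratedBySupport [AddCommGroup G] (ℒ : G → Submodule F L) : Prop :=
  AddSubgroup.closure {g : G | ℒ g ≠ ⊥} = ⊤

/-- The decomposition of `L` underlying a grading: the set of nonzero homogeneous components,
without their labels. -/
def components (ℒ : G → Submodule F L) : Set (Submodule F L) :=
  {W | W ≠ ⊥ ∧ ∃ g, ℒ g = W}

/-- The grading `ℳ` refines the grading `ℒ` (and `ℒ` coarsens `ℳ`): every nonzero component of `ℒ`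
is a sum of components of `ℳ`. The sum is automatically direct, since distinct components of the
grading `ℳ` are independent. No relation between the two grading groups is required. -/
def IsRefinement {H : Type*} (ℳ : H → Submodule F L) (ℒ : G → Submodule F L) : Prop :=
  ∀ g, ℒ g ≠ ⊥ → ∃ S : Set H, ℒ g = ⨆ h ∈ S, ℳ h

/-- A grading is fine if its only refinement among the gradings of `L` by abelian groups (generated
by their supports) is the given grading, that is, every refinement has the same nonzero
homogeneous components. -/
def IsFine (ℒ : G → Submodule F L) : Prop :=
  ∀ (H : Type v) [AddCommGroup H] [DecidableEq H] (ℳ : H → Submodule F L) [GradedLieAlgebra ℳ],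
    GeneratedBySupport ℳ → IsRefinement ℳ ℒ → components ℳ = components ℒ

/-- The homogeneous component of degree zero, as a Lie subalgebra. -/
def zeroComponent [DecidableEq G] [AddCommGroup G] (ℒ : G → Submodule F L) [GradedLieAlgebra ℒ] :
    LieSubalgebra F L :=
  { ℒ 0 with
    lie_mem' := fun {x y} hx hy => by
      have h := SetLike.GradedBracket.bracket_mem (ℒ := ℒ) (i := 0) (j := 0) hx hy
      rwa [add_zero] at h }

/-- The quasitorus producing the grading: the automorphisms of `L` for which every homogeneous
component consists of eigenvectors for one eigenvalue. It is given here as a set of endomorphisms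
of the vector space `L`. -/
def quasitorus (ℒ : G → Submodule F L) : Set (Module.End F L) :=
  {φ | ∃ f : L ≃ₗ⁅F⁆ L, (∀ x, f x = φ x) ∧ ∀ g, ∃ c : F, ∀ x ∈ ℒ g, f x = c • x}

end Gradings

section Elements

variable (F : Type*) {L : Type*} [Field F] [LieRing L] [LieAlgebra F L]

/-- An element of a Lie algebra is semisimple if its adjoint endomorphism is. -/
def IsSemisimpleElement (x : L) : Prop := (LieAlgebra.ad F L x).IsSemisimple

/-- An element of a Lie algebra is nilpotent if its adjoint endomorphism is. -/
def IsNilpotentElement (x : L) : Prop := IsNilpotent (LieAlgebra.ad F L x)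

variable {F}

/-- A subalgebra is toral if it consists of semisimple elements of the ambient algebra. -/
def IsToral (H : LieSubalgebra F L) : Prop := ∀ x ∈ H, IsSemisimpleElement F x

end Elements

/-- The dimension, as an algebraic set, of a set `S` of endomorphisms of a finite-dimensional
vector space: the Krull dimension of the ring of polynomial functions on `S`, i.e. of the quotient
of the polynomial ring in the matrix entries by the ideal of polynomials vanishing on `S`. -/
noncomputable def algebraicDim {F V : Type*} [Field F] [AddCommGroup V] [Module F V]
    [FiniteDimensional F V] (S : Set (Module.End F V)) : WithBot ℕ∞ :=
  let b := Module.finBasis F V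
  ringKrullDim (MvPolynomial (Fin (Module.finrank F V) × Fin (Module.finrank F V)) F ⧸
    MvPolynomial.vanishingIdeal F
      ((fun (φ : Module.End F V) p => LinearMap.toMatrix b b φ p.1 p.2) '' S))

end LieGrading

/-! If `s` in `L_0` is semisimple, intersecting the components with the eigenspaces of `ad s` gives
a refinement graded by `G × F`. Fineness therefore makes `s` act on each component as a scalar
(`IsFine.exists_lie_eq_smul`), and on `L_0` this scalar is zero because `[s, s] = 0`. Characters of
the finitely generated group `G` separate its points and act by automorphisms, so by uniqueness the
Jordan parts of a homogeneous element share its degree. Hence elements of `L_0` act on `L_0` as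
their nilpotent parts do. By Engel `L_0` is nilpotent, and the weight formula for the Killing form,
nondegenerate on `L_0`, kills its nilpotent elements: `L_0` is toral and abelian.

In degree `g` there are two cases. If some element of `L_0` acts on `L_g` by a nonzero scalar, every
`x` in `L_g` is nilpotent. If `L_0` centralizes `L_g`, invariance of the Killing form shows that
`L_g` has no nonzero nilpotent element, so Jordan parts leave only semisimple ones.

For the dimension, `G` is replaced by the universal group `U` of the grading, since only relations
coming from nonzero brackets constrain diagonal maps. The quasitorus is `Hom(U, Fˣ)` with coordinate
ring `F[U]`, whose Krull dimension is the rank of `U`, that is `dim Hom(U, F)`. Elements of `Hom(U,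
F)` are diagonal derivations; these are inner, and `ad` identifies `L_0` with them. -/

section KrullDimension

/-- An integral extension of commutative rings preserves the Krull dimension. -/
theorem ringKrullDim_eq_of_isIntegral {R S : Type*} [CommRing R] [CommRing S] [Algebra R S]
    [Algebra.IsIntegral R S] (hinj : Function.Injective (algebraMap R S)) :
    ringKrullDim R = ringKrullDim S := by
  apply le_antisymm
  · refine iSup_le fun l => ?_
    have hker : RingHom.ker (algebraMap R S) = ⊥ := (RingHom.injective_iff_ker_eq_bot _).mp hinj
    obtain ⟨Q, -, hQ, hcomap⟩ := Ideal.exists_ideal_over_prime_of_isIntegral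
      (S := S) l.head.asIdeal ⊥ (by
        rw [← RingHom.ker_eq_comap_bot, hker]; exact bot_le)
    have : Q.LiesOver l.head.asIdeal := ⟨hcomap.symm⟩
    obtain ⟨M, hM, -, -⟩ := Ideal.exists_ltSeries_of_hasGoingUp l Q
    exact le_iSup_of_le M (by rw [hM])
  · refine Order.krullDim_le_of_strictMono (PrimeSpectrum.comap (algebraMap R S)) ?_
    intro I J hIJ
    exact Ideal.IsIntegral.comap_lt_comap (I := I.asIdeal) (J := J.asIdeal) hIJ

end KrullDimension

/-! ### Characters and group algebras of finitely generated abelian groups. -/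

namespace AddMonoidAlgebra

variable {F U : Type*} [Field F] [AddCommGroup U]

/-- The multiplicative characters of an abelian group separate the elements of the group algebra
as soon as they separate the elements of the group. -/
theorem eq_zero_of_forall_lift_eq_zero
    (hsep : ∀ u : U, u ≠ 0 → ∃ χ : Multiplicative U →* F, χ (.ofAdd u) ≠ 1)
    (p : AddMonoidAlgebra F U) (hp : ∀ χ : Multiplicative U →* F, lift F F U χ p = 0) : p = 0 := by
  have hinj : Function.Injective
      (fun u : U => (MonoidHom.eval (Multiplicative.ofAdd u) : (Multiplicative U →* F) →* F)) := by
    intro u w huw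
    by_contra hne
    obtain ⟨χ, hχ⟩ := hsep (u - w) (sub_ne_zero.mpr hne)
    have h1 : χ (.ofAdd u) = χ (.ofAdd w) := DFunLike.congr_fun huw χ
    apply hχ
    have h2 : χ (.ofAdd (u - w)) * χ (.ofAdd w) = χ (.ofAdd w) := by
      rw [← map_mul, ← ofAdd_add, sub_add_cancel, h1]
    have h3 : χ (.ofAdd w) ≠ 0 := by
      have : IsUnit (χ (.ofAdd w)) := (Group.isUnit (Multiplicative.ofAdd w)).map χ
      exact this.ne_zero
    exact mul_right_cancel₀ h3 (by rw [h2, one_mul])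
  -- Dedekind's independence of characters with the roles exchanged: each `u` is a character of the
  -- monoid of all `χ`.
  have hli := (linearIndependent_monoidHom (Multiplicative U →* F) F).comp _ hinj
  have := linearIndependent_iff.mp hli p.coeff (by
    funext χ
    have := hp χ
    rw [lift_apply] at this
    rw [Finsupp.linearCombination_apply, Finsupp.sum, Finset.sum_apply]
    simpa [Finsupp.sum] using this)
  ext u
  simpa using DFunLike.congr_fun this u

end AddMonoidAlgebra

namespace AddCommGroup

variable {F U T : Type*} [Field F] [AddCommGroup U] [AddCommGroup T] {n : ℕ}

/-- A homomorphism out of `ℤⁿ × T` that is prescribed on the standard basis and on `T`. -/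
noncomputable def liftFreeProd {A : Type*} [AddCommGroup A] (t : Fin n → A) (τ : T →+ A) :
    (Fin n →₀ ℤ) × T →+ A :=
  (Finsupp.linearCombination ℤ t).toAddMonoidHom.coprod τ

@[simp] theorem liftFreeProd_single {A : Type*} [AddCommGroup A] (t : Fin n → A) (τ : T →+ A)
    (i : Fin n) (k : ℤ) : liftFreeProd t τ (Finsupp.single i k, 0) = k • t i := by
  simp [liftFreeProd]

/-- The multiplicative character attached to an additive homomorphism into the units. -/
def unitsCharacter (f : U →+ Additive Fˣ) : Multiplicative U →* F :=
  (Units.coeHom F).comp (AddMonoidHom.toMultiplicativeLeft f)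

theorem unitsCharacter_apply (f : U →+ Additive Fˣ) (u : U) :
    unitsCharacter f (.ofAdd u) = ((f u).toMul : F) := rfl

theorem exists_character_ne_one_of_finite [IsAlgClosed F] [CharZero F] [Finite T]
    {a : T} (ha : a ≠ 0) : ∃ τ : T →+ Additive Fˣ, τ a ≠ 0 := by
  have : NeZero (Monoid.exponent (Multiplicative T)) := ⟨Monoid.exponent_ne_zero_of_finite⟩
  have : NeZero ((Monoid.exponent (Multiplicative T) : ℕ) : F) := NeZero.charZero
  obtain ⟨φ, hφ⟩ := CommGroup.exists_apply_ne_one_of_hasEnoughRootsOfUnity (Multiplicative T) F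
    (a := .ofAdd a) (by simpa using ha)
  exact ⟨AddMonoidHom.toMultiplicativeLeft.symm φ, fun h => hφ h⟩

theorem exists_character_ne_one_of_equiv [IsAlgClosed F] [CharZero F] [Finite T]
    (e : U ≃+ (Fin n →₀ ℤ) × T) (u : U) (hu : u ≠ 0) :
    ∃ χ : Multiplicative U →* F, χ (.ofAdd u) ≠ 1 := by
  suffices h : ∃ f : (Fin n →₀ ℤ) × T →+ Additive Fˣ, f (e u) ≠ 0 by
    obtain ⟨f, hf⟩ := h
    refine ⟨unitsCharacter (f.comp e.toAddMonoidHom), fun h => hf ?_⟩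
    rw [unitsCharacter_apply, Units.val_eq_one] at h
    exact h
  by_cases hT : (e u).2 = 0
  · have h1 : (e u).1 ≠ 0 := fun h => hu (by
      have : e u = 0 := Prod.ext h hT
      simpa using this)
    obtain ⟨i, hi⟩ := Finsupp.ne_iff.mp h1
    -- The `i`-th generator goes to 2, which has infinite multiplicative order in characteristic
    -- zero.
    refine ⟨liftFreeProd (Pi.single i (Additive.ofMul (Units.mk0 (2 : F) two_ne_zero))) 0, ?_⟩
    intro h
    have h2 : (e u).1 i • (Additive.ofMul (Units.mk0 (2 : F) two_ne_zero)) = 0 := by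
      rw [← h]
      simp only [liftFreeProd, AddMonoidHom.coprod_apply, AddMonoidHom.zero_apply, add_zero]
      change _ = Finsupp.linearCombination ℤ _ (e u).1
      rw [Finsupp.linearCombination_apply, Finsupp.sum_fintype _ _ (by simp),
        Finset.sum_eq_single i (by intro j _ hj; simp [hj]) (by simp)]
      simp
    have h3 : (Units.mk0 (2 : F) two_ne_zero) ^ ((e u).1 i) = 1 := h2
    have h4 : (2 : F) ^ ((e u).1 i) = 1 := by simpa using congrArg (Units.val) h3
    have h5 : (2 : ℚ) ^ ((e u).1 i) = 1 := by
      have : ((2 ^ ((e u).1 i) : ℚ) : F) = ((1 : ℚ) : F) := by push_cast; exact h4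
      exact_mod_cast this
    exact hi ((zpow_eq_one_iff_right₀ (by norm_num) (by norm_num)).mp h5)
  · obtain ⟨τ, hτ⟩ := exists_character_ne_one_of_finite (F := F) hT
    exact ⟨τ.comp (AddMonoidHom.snd _ _), hτ⟩

/-- The homomorphisms from `ℤⁿ × T` with `T` finite to a field of characteristic zero. -/
theorem finrank_addMonoidHom_of_equiv [CharZero F] [Finite T] (e : U ≃+ (Fin n →₀ ℤ) × T) :
    Module.finrank F (U →+ F) = n := by
  let ev : (U →+ F) →ₗ[F] (Fin n → F) :=
    { toFun f i := f (e.symm (Finsupp.single i 1, 0))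
      map_add' _ _ := rfl
      map_smul' _ _ := rfl }
  have hbij : Function.Bijective ev := by
    refine ⟨(injective_iff_map_eq_zero ev).mpr fun f hf => ?_, fun t => ?_⟩
    · have h1 : (f.comp e.symm.toAddMonoidHom).comp (AddMonoidHom.inl (Fin n →₀ ℤ) T) = 0 := by
        ext i
        exact congrFun hf i
      have h2 : (f.comp e.symm.toAddMonoidHom).comp (AddMonoidHom.inr (Fin n →₀ ℤ) T) = 0 := by
        ext x
        obtain ⟨m, hm, hmx⟩ := isOfFinAddOrder_iff_nsmul_eq_zero.mp (isOfFinAddOrder_of_finite x)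
        have h := congrArg ((f.comp e.symm.toAddMonoidHom).comp
          (AddMonoidHom.inr (Fin n →₀ ℤ) T)) hmx
        rw [map_nsmul, map_zero, smul_eq_zero] at h
        exact h.resolve_left hm.ne'
      have key : f.comp e.symm.toAddMonoidHom = 0 := by
        rw [← AddMonoidHom.coprod_unique (f.comp e.symm.toAddMonoidHom), h1, h2]
        ext
        simp
      ext u
      simpa using DFunLike.congr_fun key (e u)
    · refine ⟨(liftFreeProd t 0).comp e.toAddMonoidHom, ?_⟩
      funext i
      simp [ev]
  rw [(LinearEquiv.ofBijective ev hbij).finrank_eq, Module.finrank_fin_fun]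

end AddCommGroup

namespace AddMonoidAlgebra

variable {F U T : Type*} [Field F] [AddCommGroup U] [AddCommGroup T] {n : ℕ}

/-- The map `Xᵢ ↦ bᵢ + bᵢ⁻¹` from a polynomial ring to a group algebra. -/
noncomputable def symmetrizedAeval (F : Type*) [Field F] (b : Fin n → U) :
    MvPolynomial (Fin n) F →ₐ[F] AddMonoidAlgebra F U :=
  MvPolynomial.aeval fun i => single (b i) 1 + single (-b i) 1

/-- Every point `a` of affine space is reached by a character: solve `t + t⁻¹ = a i`, a quadratic
with constant term 1, so its root is a unit. A polynomial in the kernel thus vanishes at every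
point. -/
theorem symmetrizedAeval_injective [IsAlgClosed F] (e : U ≃+ (Fin n →₀ ℤ) × T) :
    Function.Injective
      (symmetrizedAeval F fun i => e.symm (Finsupp.single i (1 : ℤ), (0 : T))) := by
  rw [injective_iff_map_eq_zero]
  intro p hp
  refine MvPolynomial.funext fun a => ?_
  have hroot : ∀ i, ∃ t : Fˣ, (t : F) + (t : F)⁻¹ = a i := by
    intro i
    obtain ⟨x, hx⟩ := IsAlgClosed.exists_root
      (Polynomial.X ^ 2 - Polynomial.C (a i) * Polynomial.X + 1 : Polynomial F) (by
        have : (Polynomial.X ^ 2 - Polynomial.C (a i) * Polynomial.X + 1 : Polynomial F).degree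
            = 2 := by compute_degree!
        rw [this]; norm_num)
    simp only [Polynomial.IsRoot, Polynomial.eval_add, Polynomial.eval_sub, Polynomial.eval_pow,
      Polynomial.eval_X, Polynomial.eval_mul, Polynomial.eval_C, Polynomial.eval_one] at hx
    have hx0 : x ≠ 0 := by rintro rfl; simp at hx
    refine ⟨Units.mk0 x hx0, ?_⟩
    simp only [Units.val_mk0]
    field_simp
    linear_combination hx
  choose t ht using hroot
  let χ := AddCommGroup.unitsCharacter (F := F)
    ((AddCommGroup.liftFreeProd (fun i => Additive.ofMul (t i)) (0 : T →+ _)).comp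
      e.toAddMonoidHom)
  have hcomp : ((lift F F U χ).comp (symmetrizedAeval F fun i =>
      e.symm (Finsupp.single i (1 : ℤ), (0 : T)))) = MvPolynomial.aeval a := by
    apply MvPolynomial.algHom_ext
    intro i
    simp only [symmetrizedAeval, AlgHom.comp_apply, MvPolynomial.aeval_X, map_add, lift_single,
      one_smul, ← ht i, χ, AddCommGroup.unitsCharacter_apply, map_neg]
    simp
  have := DFunLike.congr_fun hcomp p
  rw [AlgHom.comp_apply, hp, map_zero] at this
  rw [map_zero, ← MvPolynomial.coe_aeval_eq_eval]
  exact this.symm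

/-- Together with injectivity this is an explicit Noether normalization. Free generators and their
inverses are integral as the roots of `X² - pX + 1`; torsion elements are roots of unity. -/
theorem symmetrizedAeval_isIntegral [Finite T] (e : U ≃+ (Fin n →₀ ℤ) × T) :
    (symmetrizedAeval F fun i =>
      e.symm (Finsupp.single i (1 : ℤ), (0 : T))).toRingHom.IsIntegral := by
  set b : Fin n → U := fun i => e.symm (Finsupp.single i (1 : ℤ), (0 : T)) with hb
  set φ := symmetrizedAeval F b with hφ
  let _ := φ.toRingHom.toAlgebra
  have halg : ∀ p, algebraMap (MvPolynomial (Fin n) F) (AddMonoidAlgebra F U) p = φ p :=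
    fun _ => rfl
  have hadd : ∀ u w : U, IsIntegral (MvPolynomial (Fin n) F) (single u (1 : F)) →
      IsIntegral (MvPolynomial (Fin n) F) (single w (1 : F)) →
      IsIntegral (MvPolynomial (Fin n) F) (single (u + w) (1 : F)) := by
    intro u w hu hw
    simpa [single_mul_single] using hu.mul hw
  have hgen : ∀ x y : U, x + y = 0 → ∀ p, φ p = single x (1 : F) + single y 1 →
      IsIntegral (MvPolynomial (Fin n) F) (single x (1 : F)) := by
    intro x y hxy p hp
    refine ⟨Polynomial.X ^ 2 - Polynomial.C p * Polynomial.X + 1, ?_, ?_⟩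
    · monicity!
    · have h1 : (single x (1 : F)) * single y 1 = 1 := by
        rw [single_mul_single, hxy, mul_one]; rfl
      simp only [Polynomial.eval₂_add, Polynomial.eval₂_sub, Polynomial.eval₂_pow,
        Polynomial.eval₂_X, Polynomial.eval₂_mul, Polynomial.eval₂_C, Polynomial.eval₂_one,
        halg, hp]
      linear_combination -h1
  have hX : ∀ i, φ (MvPolynomial.X i) = single (b i) (1 : F) + single (-b i) 1 := fun i => by
    simp [hφ, symmetrizedAeval]
  have htor : ∀ t : T, IsIntegral (MvPolynomial (Fin n) F) (single (e.symm (0, t)) (1 : F)) := by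
    intro t
    obtain ⟨m, hm, hmt⟩ := isOfFinAddOrder_iff_nsmul_eq_zero.mp (isOfFinAddOrder_of_finite t)
    refine IsIntegral.of_pow hm ?_
    have : m • e.symm ((0 : Fin n →₀ ℤ), t) = 0 := by
      rw [← map_nsmul, Prod.smul_mk, hmt, smul_zero]
      exact map_zero e.symm
    rw [single_pow, this, one_pow]
    exact isIntegral_one
  have hfree : ∀ a : Fin n →₀ ℤ,
      IsIntegral (MvPolynomial (Fin n) F) (single (e.symm (a, (0 : T))) (1 : F)) := by
    intro a
    have hzero : IsIntegral (MvPolynomial (Fin n) F)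
        (single (e.symm ((0 : Fin n →₀ ℤ), (0 : T))) (1 : F)) := htor 0
    have hsum : ∀ a a' : Fin n →₀ ℤ,
        e.symm (a + a', (0 : T)) = e.symm (a, (0 : T)) + e.symm (a', (0 : T)) := by
      intro a a'; rw [← map_add, Prod.mk_add_mk, add_zero]
    induction a using Finsupp.induction_linear with
    | zero => exact hzero
    | add f g hf hg => rw [hsum]; exact hadd _ _ hf hg
    | single i k =>
      have hneg : e.symm (Finsupp.single i (-1 : ℤ), (0 : T)) = -b i := by
        rw [hb, ← map_neg, Prod.neg_mk, neg_zero, Finsupp.single_neg]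
      induction k using Int.induction_on with
      | zero => simpa using hzero
      | succ k ih =>
        rw [Finsupp.single_add, hsum]
        exact hadd _ _ ih (hgen (b i) (-b i) (by simp) _ (hX i))
      | pred k ih =>
        rw [sub_eq_add_neg, Finsupp.single_add, hsum]
        refine hadd _ _ ih ?_
        rw [hneg]
        exact hgen (-b i) (b i) (by simp) _ (by rw [hX i, add_comm])
  intro x
  change IsIntegral (MvPolynomial (Fin n) F) x
  induction x using AddMonoidAlgebra.induction_on with
  | of u =>
    have : u = e.symm ((e u).1, 0) + e.symm (0, (e u).2) := by
      rw [← map_add]; simp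
    rw [of_apply, toAdd_ofAdd, this]
    exact hadd _ _ (hfree _) (htor _)
  | add x y hx hy => exact hx.add hy
  | smul r x hx =>
    have : r • x = φ (MvPolynomial.C r) * x := by
      rw [MvPolynomial.C_eq_algebraMap, AlgHom.commutes, Algebra.smul_def]
    rw [this]
    exact (isIntegral_algebraMap (x := MvPolynomial.C r)).mul hx

/-- The Krull dimension of the group algebra of a finitely generated abelian group is the rank of
the group. -/
theorem ringKrullDim_of_equiv [IsAlgClosed F] [Finite T] (e : U ≃+ (Fin n →₀ ℤ) × T) :
    ringKrullDim (AddMonoidAlgebra F U) = n := by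
  let _ := (symmetrizedAeval F fun i =>
      e.symm (Finsupp.single i (1 : ℤ), (0 : T))).toRingHom.toAlgebra
  have : Algebra.IsIntegral (MvPolynomial (Fin n) F) (AddMonoidAlgebra F U) :=
    ⟨symmetrizedAeval_isIntegral e⟩
  rw [← ringKrullDim_eq_of_isIntegral (R := MvPolynomial (Fin n) F)
    (symmetrizedAeval_injective e), MvPolynomial.ringKrullDim_of_isNoetherianRing,
    ringKrullDim_eq_zero_of_field]
  simp

end AddMonoidAlgebra

namespace AddCommGroup

variable (F U : Type*) [Field F] [AddCommGroup U] [AddGroup.FG U] [IsAlgClosed F] [CharZero F]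

theorem exists_equiv_free_prod_finite (U : Type*) [AddCommGroup U] [AddGroup.FG U] :
    ∃ (n : ℕ) (T : Type) (_ : AddCommGroup T) (_ : Finite T),
      Nonempty (U ≃+ (Fin n →₀ ℤ) × T) := by
  obtain ⟨n, ι, _, p, hp, k, ⟨e⟩⟩ := AddCommGroup.equiv_free_prod_directSum_zmod U
  have : ∀ i, NeZero (p i ^ k i) := fun i => ⟨pow_ne_zero _ (hp i).ne_zero⟩
  classical
  exact ⟨n, _, inferInstance,
    Finite.of_equiv _ (DirectSum.addEquivProd fun i => ZMod (p i ^ k i)).symm.toEquiv, ⟨e⟩⟩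

/-- The characters of a finitely generated abelian group separate its elements. -/
theorem exists_character_ne_one (u : U) (hu : u ≠ 0) :
    ∃ χ : Multiplicative U →* F, χ (.ofAdd u) ≠ 1 := by
  obtain ⟨n, T, _, _, ⟨e⟩⟩ := exists_equiv_free_prod_finite U
  exact exists_character_ne_one_of_equiv e u hu

theorem ringKrullDim_addMonoidAlgebra :
    ringKrullDim (AddMonoidAlgebra F U) = Module.finrank F (U →+ F) := by
  obtain ⟨n, T, _, _, ⟨e⟩⟩ := exists_equiv_free_prod_finite U
  rw [AddMonoidAlgebra.ringKrullDim_of_equiv e, finrank_addMonoidHom_of_equiv e]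

end AddCommGroup

/-! ### Gradings and the diagonal maps they carry. -/

namespace LieGrading

open Module

section Decomposition

variable {F L G : Type*} [Field F] [LieRing L] [LieAlgebra F L] [AddCommGroup G] [DecidableEq G]

/-- A family of subspaces compatible with the bracket and with internal direct sum `L` is a
grading of `L`. -/
@[reducible]
noncomputable def gradedOfIsInternal (ℒ : G → Submodule F L)
    (hbr : ∀ ⦃i j : G⦄ ⦃x y : L⦄, x ∈ ℒ i → y ∈ ℒ j → ⁅x, y⁆ ∈ ℒ (i + j))
    (hint : DirectSum.IsInternal ℒ) : GradedLieAlgebra ℒ where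
  bracket_mem _ _ _ _ := fun hx hy => hbr hx hy
  toDecomposition := hint.chooseDecomposition

variable (ℒ : G → Submodule F L) [GradedLieAlgebra ℒ]

theorem isInternal : DirectSum.IsInternal ℒ := DirectSum.Decomposition.isInternal ℒ

theorem iSupIndep_components : iSupIndep ℒ := (isInternal ℒ).submodule_iSupIndep

theorem iSup_components : ⨆ g, ℒ g = ⊤ := (isInternal ℒ).submodule_iSup_eq_top

variable {ℒ}

theorem lie_mem {g h : G} {x y : L} (hx : x ∈ ℒ g) (hy : y ∈ ℒ h) : ⁅x, y⁆ ∈ ℒ (g + h) :=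
  SetLike.GradedBracket.bracket_mem hx hy

variable (ℒ) in
theorem homogeneous_induction {p : L → Prop} (hmem : ∀ g, ∀ x ∈ ℒ g, p x)
    (hadd : ∀ x y, p x → p y → p (x + y)) (x : L) : p x := by
  have h0 : p 0 := hmem 0 0 (zero_mem _)
  induction x using DirectSum.Decomposition.inductionOn ℒ with
  | zero => exact h0
  | homogeneous m => exact hmem _ m m.2
  | add m m' hm hm' => exact hadd _ _ hm hm'

theorem linearMap_ext {M : Type*} [AddCommGroup M] [Module F M] {f f' : L →ₗ[F] M}
    (h : ∀ g, ∀ x ∈ ℒ g, f x = f' x) : f = f' := by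
  ext x
  induction x using homogeneous_induction ℒ with
  | hmem g x hx => exact h g x hx
  | hadd x y hx hy => rw [map_add, map_add, hx, hy]

variable (ℒ) in
/-- The endomorphism of `L` that acts on the component of degree `g` as the scalar `c g`. -/
noncomputable def scale (c : G → F) : End F L :=
  (DirectSum.toModule F G L fun g => c g • (ℒ g).subtype) ∘ₗ
    (DirectSum.decomposeLinearEquiv ℒ).toLinearMap

theorem scale_apply (c : G → F) {g : G} {x : L} (hx : x ∈ ℒ g) : scale ℒ c x = c g • x := by
  simp only [scale, LinearMap.comp_apply, LinearEquiv.coe_coe,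
    DirectSum.decomposeLinearEquiv_apply]
  rw [DirectSum.decompose_of_mem ℒ hx, ← DirectSum.lof_eq_of F, DirectSum.toModule_lof]
  simp

theorem eq_scale {c : G → F} {f : L →ₗ[F] L} (h : ∀ g, ∀ x ∈ ℒ g, f x = c g • x) :
    f = scale ℒ c :=
  linearMap_ext fun g x hx => by rw [h g x hx, scale_apply c hx]

/-- A function on the support that is additive along nonzero brackets yields a derivation. -/
noncomputable def scaleDerivation (c : G → F)
    (hc : ∀ g h, ∀ x ∈ ℒ g, ∀ y ∈ ℒ h, ⁅x, y⁆ ≠ 0 → c (g + h) = c g + c h) :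
    LieDerivation F L L where
  toLinearMap := scale ℒ c
  leibniz' a b := by
    induction a using homogeneous_induction ℒ with
    | hadd a a' ha ha' => simp only [add_lie, map_add, lie_add] at *; rw [ha, ha']; abel
    | hmem g a ha =>
      induction b using homogeneous_induction ℒ with
      | hadd b b' hb hb' => simp only [add_lie, map_add, lie_add] at *; rw [hb, hb']; abel
      | hmem h b hb =>
        rw [scale_apply c ha, scale_apply c hb, scale_apply c (lie_mem ha hb), lie_smul, lie_smul,
          ← lie_skew b a, smul_neg, sub_neg_eq_add, add_comm, ← add_smul]
        by_cases h0 : ⁅a, b⁆ = 0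
        · simp [h0]
        · rw [add_comm h, hc g h a ha b hb h0, add_comm (c h)]

/-- A nowhere vanishing function on the support that is multiplicative along nonzero brackets
yields an automorphism. -/
noncomputable def scaleEquiv (c : G → F) (h0 : ∀ g, c g ≠ 0)
    (hc : ∀ g h, ∀ x ∈ ℒ g, ∀ y ∈ ℒ h, ⁅x, y⁆ ≠ 0 → c (g + h) = c g * c h) : L ≃ₗ⁅F⁆ L where
  __ := scale ℒ c
  map_lie' {a b} := by
    change scale ℒ c _ = ⁅scale ℒ c _, scale ℒ c _⁆
    induction a using homogeneous_induction ℒ with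
    | hadd a a' ha ha' => simp only [add_lie, map_add] at *; rw [ha, ha']
    | hmem g a ha =>
      induction b using homogeneous_induction ℒ with
      | hadd b b' hb hb' => simp only [map_add, lie_add] at *; rw [hb, hb']
      | hmem h b hb =>
        rw [scale_apply c ha, scale_apply c hb, scale_apply c (lie_mem ha hb), lie_smul, smul_lie,
          smul_smul]
        by_cases h0 : ⁅a, b⁆ = 0
        · simp [h0]
        · rw [hc g h a ha b hb h0, mul_comm]
  invFun := scale ℒ (fun g => (c g)⁻¹)
  left_inv x := by
    change scale ℒ _ (scale ℒ c x) = x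
    induction x using homogeneous_induction ℒ with
    | hadd x y hx hy => rw [map_add, map_add, hx, hy]
    | hmem g x hx => rw [scale_apply c hx, map_smul, scale_apply _ hx, smul_smul,
        mul_inv_cancel₀ (h0 g), one_smul]
  right_inv x := by
    change scale ℒ c (scale ℒ _ x) = x
    induction x using homogeneous_induction ℒ with
    | hadd x y hx hy => rw [map_add, map_add, hx, hy]
    | hmem g x hx => rw [scale_apply _ hx, map_smul, scale_apply _ hx, smul_smul,
        inv_mul_cancel₀ (h0 g), one_smul]

variable (ℒ) in
theorem finite_support [FiniteDimensional F L] : {g : G | ℒ g ≠ ⊥}.Finite :=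
  WellFoundedGT.finite_ne_bot_of_iSupIndep (iSupIndep_components ℒ)

theorem fg_of_generatedBySupport [FiniteDimensional F L] (hgen : GeneratedBySupport ℒ) :
    AddGroup.FG G :=
  (AddGroup.fg_iff).mpr ⟨_, hgen, finite_support ℒ⟩

/-- An element on which every automorphism produced by a character of the grading group acts
as on the component of degree `g` belongs to that component. -/
theorem mem_of_forall_character
    (hsep : ∀ u : G, u ≠ 0 → ∃ χ : Multiplicative G →* F, χ (.ofAdd u) ≠ 1) {g : G} {x : L}
    (hx : ∀ χ : Multiplicative G →* F, scale ℒ (fun h => χ (.ofAdd h)) x = χ (.ofAdd g) • x) :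
    x ∈ ℒ g := by
  classical
  have hdec : ∀ (c : G → F) (y : L) (h : G),
      (DirectSum.decompose ℒ (scale ℒ c y) h : L) = c h • (DirectSum.decompose ℒ y h : L) := by
    intro c y h
    induction y using homogeneous_induction ℒ with
    | hadd x y hx hy => simp [hx, hy]
    | hmem k y hy =>
      rw [scale_apply c hy, DirectSum.decompose_smul]
      by_cases hk : k = h
      · subst hk; simp [DirectSum.smul_apply]
      · simp [DirectSum.smul_apply, DirectSum.decompose_of_mem_ne ℒ hy hk]
  have hcomp : ∀ h, h ≠ g → (DirectSum.decompose ℒ x h : L) = 0 := by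
    intro h hne
    by_contra h0
    obtain ⟨χ, hχ⟩ := hsep (h - g) (sub_ne_zero.mpr hne)
    have h1 := hdec (fun h => χ (.ofAdd h)) x h
    rw [hx χ, DirectSum.decompose_smul] at h1
    have h2 : χ (.ofAdd g) = χ (.ofAdd h) := smul_left_injective F h0 h1
    have h3 : χ (.ofAdd (h - g)) * χ (.ofAdd g) = χ (.ofAdd g) := by
      rw [← map_mul, ← ofAdd_add, sub_add_cancel, h2]
    have h4 : χ (.ofAdd g) ≠ 0 := ((Group.isUnit (Multiplicative.ofAdd g)).map χ).ne_zero
    exact hχ (mul_right_cancel₀ h4 (by rw [h3, one_mul]))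
  rw [← DirectSum.sum_support_decompose ℒ x]
  refine Submodule.sum_mem _ fun h _ => ?_
  by_cases hne : h = g
  · subst hne; exact SetLike.coe_mem _
  · rw [hcomp h hne]; exact zero_mem _

end Decomposition

section Independent

/-- In a vanishing sum, grouping by the first index makes each partial sum vanish by independence of
`f`; independence of `f'` then kills its terms. -/
theorem iSupIndep_inf_prod {F V ι κ : Type*} [Field F] [AddCommGroup V] [Module F V]
    {f : ι → Submodule F V} {f' : κ → Submodule F V} (hf : iSupIndep f) (hf' : iSupIndep f') :
    iSupIndep fun p : ι × κ => f p.1 ⊓ f' p.2 := by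
  classical
  rw [iSupIndep_iff_finsetSum_eq_zero_imp_eq_zero] at hf hf' ⊢
  intro s v hv h0 p hp
  have h1 : ∑ q ∈ s with q.1 = p.1, v q = 0 := by
    refine hf (s.image Prod.fst) (fun i => ∑ q ∈ s with q.1 = i, v q) (fun i _ => ?_) ?_ p.1
      (Finset.mem_image_of_mem _ hp)
    · refine Submodule.sum_mem _ fun q hq => ?_
      obtain ⟨hqs, rfl⟩ := Finset.mem_filter.mp hq
      exact (hv q hqs).1
    · exact (Finset.sum_fiberwise_of_maps_to
        (fun q hq => Finset.mem_image_of_mem Prod.fst hq) v).trans h0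
  refine hf' ((s.filter fun q => q.1 = p.1).image Prod.snd) (fun c => v (p.1, c)) (fun c hc => ?_)
    ?_ p.2 (Finset.mem_image_of_mem _ (Finset.mem_filter.mpr ⟨hp, rfl⟩))
  · obtain ⟨q, hq, rfl⟩ := Finset.mem_image.mp hc
    obtain ⟨hq, hqp⟩ := Finset.mem_filter.mp hq
    rw [← hqp]
    exact (hv q hq).2
  · rw [Finset.sum_image, ← h1]
    · refine Finset.sum_congr rfl fun q hq => ?_
      rw [← (Finset.mem_filter.mp hq).2]
    · intro q hq r hr hqr
      exact Prod.ext ((Finset.mem_filter.mp hq).2.trans (Finset.mem_filter.mp hr).2.symm) hqr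

end Independent

/-! ### Refinements and fineness. -/

section Fine

variable {F L G : Type*} [Field F] [LieRing L] [LieAlgebra F L] [FiniteDimensional F L]
  {ℒ : G → Submodule F L}

/-- Fineness can be tested against gradings by groups in any universe, whether or not the group is
generated by the support. -/
theorem IsFine.components_eq (hfine : IsFine.{v} ℒ) {H : Type*} [AddCommGroup H] [DecidableEq H]
    (ℳ : H → Submodule F L) [GradedLieAlgebra ℳ] (href : IsRefinement ℳ ℒ) :
    components ℳ = components ℒ := by
  classical
  let K : AddSubgroup H := AddSubgroup.closure {h | ℳ h ≠ ⊥}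
  have hfg : AddGroup.FG K :=
    have := (finite_support ℳ).to_subtype
    AddGroup.closure_finite_fg _
  -- The support is finite, so the subgroup it generates is countable and has a copy in any
  -- universe.
  have hcount : Countable K := by
    obtain ⟨n, T, _, _, ⟨e⟩⟩ := AddCommGroup.exists_equiv_free_prod_finite K
    exact e.toEquiv.countable_iff.mpr inferInstance
  let e : Shrink.{v} K ≃+ K := Shrink.addEquiv
  let ι : Shrink.{v} K →+ H := K.subtype.comp e.toAddMonoidHom
  have hι : Function.Injective ι := K.subtype_injective.comp e.injective
  have hrange : ∀ h, ℳ h ≠ ⊥ → ∃ k, ι k = h := fun h hh =>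
    ⟨e.symm ⟨h, AddSubgroup.subset_closure hh⟩, by simp [ι]⟩
  let ℳ' : Shrink.{v} K → Submodule F L := fun k => ℳ (ι k)
  have hint : DirectSum.IsInternal ℳ' := by
    apply DirectSum.isInternal_submodule_of_iSupIndep_of_iSup_eq_top
    · exact (iSupIndep_components ℳ).comp hι
    · rw [eq_top_iff, ← iSup_components ℳ]
      refine iSup_le fun h => ?_
      by_cases hh : ℳ h = ⊥
      · rw [hh]; exact bot_le
      · obtain ⟨k, rfl⟩ := hrange h hh
        exact le_iSup ℳ' k
  let _ : GradedLieAlgebra ℳ' := gradedOfIsInternal ℳ' (fun i j x y hx hy => by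
    change _ ∈ ℳ _
    rw [map_add]
    exact lie_mem hx hy) hint
  have hcomp : components ℳ' = components ℳ := by
    ext W
    constructor
    · rintro ⟨hW, k, rfl⟩
      exact ⟨hW, _, rfl⟩
    · rintro ⟨hW, h, rfl⟩
      obtain ⟨k, rfl⟩ := hrange h hW
      exact ⟨hW, k, rfl⟩
  rw [← hcomp]
  refine hfine (Shrink.{v} K) ℳ' ?_ ?_
  · have h1 : (AddSubgroup.closure {k | ℳ' k ≠ ⊥}).map ι = K := by
      rw [AddMonoidHom.map_closure]
      congr 1
      ext h
      constructor
      · rintro ⟨k, hk, rfl⟩; exact hk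
      · intro hh
        obtain ⟨k, rfl⟩ := hrange h hh
        exact ⟨k, hh, rfl⟩
    rw [GeneratedBySupport, eq_top_iff]
    intro k _
    have h2 : ι k ∈ (AddSubgroup.closure {k | ℳ' k ≠ ⊥}).map ι := by
      rw [h1]; exact (e k).2
    obtain ⟨k', hk', heq⟩ := h2
    rwa [← hι heq]
  · intro g hg
    obtain ⟨S, hS⟩ := href g hg
    refine ⟨ι ⁻¹' S, le_antisymm ?_ ?_⟩
    · rw [hS]
      refine iSup₂_le fun h hh => ?_
      by_cases h0 : ℳ h = ⊥
      · rw [h0]; exact bot_le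
      · obtain ⟨k, rfl⟩ := hrange h h0
        exact le_iSup₂_of_le k hh le_rfl
    · rw [hS]
      exact iSup₂_le fun k hk => le_iSup₂_of_le (ι k) hk le_rfl

/-- A semisimple element of degree zero acts on each component of a fine grading as a scalar. -/
theorem IsFine.exists_lie_eq_smul [IsAlgClosed F] [AddCommGroup G] [DecidableEq G]
    [GradedLieAlgebra ℒ] (hfine : IsFine.{v} ℒ) {s : L} (hs : s ∈ ℒ 0)
    (hss : IsSemisimpleElement F s) (g : G) :
    ∃ c : F, ∀ x ∈ ℒ g, ⁅s, x⁆ = c • x := by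
  classical
  set D : End F L := LieAlgebra.ad F L s with hD
  have hDapp : ∀ x, D x = ⁅s, x⁆ := fun _ => rfl
  have hmaps : ∀ g, ∀ x ∈ ℒ g, D x ∈ ℒ g := fun g x hx => by
    have := lie_mem hs hx
    rwa [zero_add] at this
  -- Eigenvalues of the derivation `ad s` add under brackets, so the additive group of `F` records
  -- them as degrees.
  let ℳ : G × F → Submodule F L := fun p => ℒ p.1 ⊓ D.eigenspace p.2
  have hsup : ∀ g, ℒ g = ⨆ c : F, ℳ (g, c) := fun g =>
    Submodule.eq_iSup_inf_genEigenspace 1 (hmaps g) hss.iSup_eigenspace_eq_top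
  have hindep : iSupIndep ℳ := iSupIndep_inf_prod (iSupIndep_components ℒ) D.eigenspaces_iSupIndep
  have hint : DirectSum.IsInternal ℳ := by
    apply DirectSum.isInternal_submodule_of_iSupIndep_of_iSup_eq_top hindep
    rw [eq_top_iff, ← iSup_components ℒ]
    refine iSup_le fun g => ?_
    rw [hsup g]
    exact iSup_le fun c => le_iSup ℳ (g, c)
  let _ : GradedLieAlgebra ℳ := gradedOfIsInternal ℳ (fun i j x y hx hy => by
    refine ⟨lie_mem hx.1 hy.1, ?_⟩
    have h1 := End.mem_eigenspace_iff.mp hx.2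
    have h2 := End.mem_eigenspace_iff.mp hy.2
    rw [hDapp] at h1 h2
    refine End.mem_eigenspace_iff.mpr ?_
    rw [hDapp, leibniz_lie, h1, h2, smul_lie, lie_smul, ← add_smul]
    rfl) hint
  have hcomp := hfine.components_eq ℳ (fun g _ => ⟨{p | p.1 = g}, by
    rw [hsup g]
    apply le_antisymm
    · exact iSup_le fun c => le_iSup₂_of_le (g, c) rfl le_rfl
    · refine iSup₂_le ?_
      rintro ⟨g', c⟩ rfl
      exact le_iSup (fun c => ℳ (g', c)) c⟩)
  by_cases hg : ℒ g = ⊥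
  · exact ⟨0, fun x hx => by rw [hg, Submodule.mem_bot] at hx; simp [hx]⟩
  · obtain ⟨-, ⟨g', c⟩, hgc⟩ : ℒ g ∈ components ℳ := by
      rw [hcomp]; exact ⟨hg, g, rfl⟩
    refine ⟨c, fun x hx => ?_⟩
    rw [← hgc] at hx
    exact End.mem_eigenspace_iff.mp hx.2

end Fine

end LieGrading

namespace LieGrading

open Module LieAlgebra

/-! ### The abstract Jordan decomposition. -/

section Jordan

variable {F L : Type*} [Field F] [LieRing L] [LieAlgebra F L] [FiniteDimensional F L]

omit [FiniteDimensional F L] in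
theorem ad_lie_eq (x y : L) :
    ad F L ⁅x, y⁆ = ad F L x * ad F L y - ad F L y * ad F L x := by
  ext z
  exact lie_lie x y z

omit [FiniteDimensional F L] in
theorem commute_ad {x y : L} (h : ⁅x, y⁆ = 0) : Commute (ad F L x) (ad F L y) :=
  sub_eq_zero.mp (by rw [← ad_lie_eq, h, map_zero])

/-- The semisimple part of a derivation is a derivation. -/
theorem leibniz_of_semisimple_part [IsAlgClosed F] {D n s : End F L}
    (hD : ∀ a b, D ⁅a, b⁆ = ⁅D a, b⁆ + ⁅a, D b⁆) (hx : ∃ x, D = ad F L x) (hns : Commute n s)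
    (hn : IsNilpotent n) (hs : s.IsSemisimple) (h : D = n + s) (a b : L) :
    s ⁅a, b⁆ = ⁅s a, b⁆ + ⁅a, s b⁆ := by
  obtain ⟨x, rfl⟩ := hx
  have hcomm : Commute (ad F L x) s := by rw [h]; exact hns.add_left (Commute.refl s)
  have hnil : IsNilpotent (ad F L x - s) := by rw [h, add_sub_cancel_right]; exact hn
  -- The semisimple part is the scalar `c` on the generalized eigenspace for `c`, and brackets add
  -- these eigenvalues.
  have happ : ∀ (c : F) (y : L), y ∈ (ad F L x).maxGenEigenspace c → s y = c • y := fun c y hy =>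
    End.apply_eq_of_mem_of_comm_of_isFinitelySemisimple_of_isNil hy hcomm
      hs.isFinitelySemisimple hnil
  have htop : ∀ y : L, y ∈ ⨆ c, (ad F L x).maxGenEigenspace c := fun y => by
    rw [End.iSup_maxGenEigenspace_eq_top]; trivial
  refine Submodule.iSup_induction _ (motive := fun a => s ⁅a, b⁆ = ⁅s a, b⁆ + ⁅a, s b⁆) (htop a)
    (fun c a ha => ?_) (by simp) (fun a a' ha ha' => ?_)
  · refine Submodule.iSup_induction _ (motive := fun b => s ⁅a, b⁆ = ⁅s a, b⁆ + ⁅a, s b⁆) (htop b)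
      (fun d b hb => ?_) (by simp) (fun b b' hb hb' => ?_)
    · have hab : ⁅a, b⁆ ∈ (ad F L x).maxGenEigenspace (c + d) :=
        LieModule.lie_mem_maxGenEigenspace_toEnd ha hb
      rw [happ _ _ hab, happ _ _ ha, happ _ _ hb, smul_lie, lie_smul, add_smul]
    · simp only [lie_add, map_add, hb, hb']; abel
  · simp only [add_lie, map_add, ha, ha']; abel

variable [CharZero F]

omit [CharZero F] in
theorem ad_injective [IsKilling F L] : Function.Injective (ad F L) :=
  (injective_iff_map_eq_zero _).mpr fun x hx =>
    (LieDerivation.IsKilling.ad_apply_eq_zero_iff F L x).mp (by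
      ext y
      exact (LieDerivation.ad_apply_apply F L x y).trans (DFunLike.congr_fun hx y))

/-- The abstract Jordan decomposition. -/
theorem exists_jordan_decomposition [IsAlgClosed F] [IsKilling F L] (x : L) :
    ∃ n s : L, IsNilpotentElement F n ∧ IsSemisimpleElement F s ∧ ⁅n, s⁆ = 0 ∧ x = n + s := by
  obtain ⟨n, hn_adj, s, hs_adj, hn, hs, h⟩ := (ad F L x).exists_isNilpotent_isSemisimple
  have hc : Commute n s := Algebra.commute_of_mem_adjoin_singleton_of_commute hs_adj
    (Algebra.commute_of_mem_adjoin_self hn_adj).symm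
  let D : LieDerivation F L L :=
    { toLinearMap := s
      leibniz' := fun a b => by
        rw [leibniz_of_semisimple_part (D := ad F L x) (by simp) ⟨x, rfl⟩ hc hn hs h,
          ← lie_skew b]
        abel }
  -- All derivations are inner, so the semisimple part of `ad x` comes from an element of `L`.
  obtain ⟨y, hy⟩ := LieDerivation.IsKilling.exists_eq_ad D
  have hys : ad F L y = s := by
    ext z
    exact (LieDerivation.ad_apply_apply F L y z).symm.trans (DFunLike.congr_fun hy z)
  have hxy : ad F L (x - y) = n := by rw [map_sub, hys, h, add_sub_cancel_right]
  refine ⟨x - y, y, ?_, ?_, ?_, by simp⟩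
  · rw [IsNilpotentElement, hxy]; exact hn
  · rw [IsSemisimpleElement, hys]; exact hs
  · apply ad_injective (F := F)
    rw [ad_lie_eq, hys, hxy, map_zero, hc.eq, sub_self]

theorem jordan_decomposition_unique [IsKilling F L] {n s n' s' : L} (hn : IsNilpotentElement F n)
    (hs : IsSemisimpleElement F s) (hn' : IsNilpotentElement F n')
    (hs' : IsSemisimpleElement F s') (hns : ⁅n, s⁆ = 0) (hns' : ⁅n', s'⁆ = 0)
    (h : n + s = n' + s') : n = n' ∧ s = s' := by
  obtain ⟨h1, h2⟩ := End.isNilpotent_isSemisimple_unique hn hs hn' hs' (commute_ad hns)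
    (commute_ad hns') (by rw [← map_add, ← map_add, h])
  exact ⟨ad_injective h1, ad_injective h2⟩

omit [CharZero F] [FiniteDimensional F L] in
theorem IsSemisimpleElement.map {s : L} (hs : IsSemisimpleElement F s) (e : L ≃ₗ⁅F⁆ L) :
    IsSemisimpleElement F (e s) := by
  refine (LinearEquiv.isSemisimple_iff (ad F L s) (ad F L (e s)) e.toLinearEquiv ?_).mp hs
  ext y
  exact e.map_lie s y

omit [CharZero F] [FiniteDimensional F L] in
theorem IsNilpotentElement.map {n : L} (hn : IsNilpotentElement F n) (e : L ≃ₗ⁅F⁆ L) :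
    IsNilpotentElement F (e n) := by
  rw [IsNilpotentElement, ← LieAlgebra.conj_ad_apply]
  exact IsNilpotent.map hn e.toLinearEquiv.conjRingEquiv

end Jordan

/-! ### Homogeneous Jordan parts and the Killing form. -/

section Graded

variable {F L G : Type*} [Field F] [LieRing L] [LieAlgebra F L] [FiniteDimensional F L]
  [AddCommGroup G] [DecidableEq G] {ℒ : G → Submodule F L} [GradedLieAlgebra ℒ] [CharZero F]

/-- The Jordan components of a homogeneous element are homogeneous of the same degree. -/
theorem exists_homogeneous_jordan_decomposition [IsAlgClosed F] [IsKilling F L]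
    (hsep : ∀ u : G, u ≠ 0 → ∃ χ : Multiplicative G →* F, χ (.ofAdd u) ≠ 1) {g : G} {x : L}
    (hx : x ∈ ℒ g) : ∃ n ∈ ℒ g, ∃ s ∈ ℒ g,
      IsNilpotentElement F n ∧ IsSemisimpleElement F s ∧ ⁅n, s⁆ = 0 ∧ x = n + s := by
  obtain ⟨n, s, hn, hs, hns, rfl⟩ := exists_jordan_decomposition (F := F) x
  have key : ∀ χ : Multiplicative G →* F,
      scale ℒ (fun h => χ (.ofAdd h)) n = χ (.ofAdd g) • n ∧
      scale ℒ (fun h => χ (.ofAdd h)) s = χ (.ofAdd g) • s := by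
    intro χ
    let e : L ≃ₗ⁅F⁆ L := scaleEquiv (ℒ := ℒ) (fun h => χ (.ofAdd h))
      (fun h => ((Group.isUnit (Multiplicative.ofAdd h)).map χ).ne_zero)
      (fun a b _ _ _ _ _ => by rw [ofAdd_add, map_mul])
    have he : ∀ y, e y = scale ℒ (fun h => χ (.ofAdd h)) y := fun _ => rfl
    rw [← he, ← he]
    -- Applying `e` and scaling by `χ(g)` give two Jordan decompositions of the same element `e x =
    -- χ(g) x`.
    refine jordan_decomposition_unique (hn.map e) (hs.map e) ?_ ?_ ?_ ?_ ?_
    · rw [IsNilpotentElement, map_smul]; exact IsNilpotent.smul hn _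
    · rw [IsSemisimpleElement, map_smul]; exact End.IsSemisimple_smul _ hs
    · rw [← LieEquiv.map_lie, hns, map_zero]
    · rw [smul_lie, lie_smul, hns, smul_zero, smul_zero]
    · rw [← map_add, he, scale_apply _ hx, smul_add]
  exact ⟨n, mem_of_forall_character hsep fun χ => (key χ).1, s,
    mem_of_forall_character hsep fun χ => (key χ).2, hn, hs, hns, rfl⟩

-- `ad x ∘ ad y` shifts every degree by `g + h ≠ 0`, so its trace is zero.
omit [CharZero F] in
theorem killingForm_eq_zero {g h : G} (hgh : g + h ≠ 0) {x y : L} (hx : x ∈ ℒ g) (hy : y ∈ ℒ h) :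
    killingForm F L x y = 0 := by
  rw [killingForm_apply_apply]
  refine LinearMap.trace_eq_zero_of_mapsTo_ne (isInternal ℒ) (fun k => g + (h + k)) (fun k hk => ?_)
    (fun k z hz => lie_mem hx (lie_mem hy hz))
  rw [← add_assoc, add_eq_right] at hk
  exact hgh hk

-- By the previous orthogonality, nondegeneracy descends to the pairing of `L_g` with `L_{-g}`.
omit [CharZero F] in
theorem eq_zero_of_killingForm_eq_zero [IsKilling F L] {g : G} {x : L} (hx : x ∈ ℒ g)
    (h : ∀ y ∈ ℒ (-g), killingForm F L x y = 0) : x = 0 := by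
  refine (IsKilling.killingForm_nondegenerate F L).1 x fun y => ?_
  induction y using homogeneous_induction ℒ with
  | hadd y z hy hz => rw [map_add, hy, hz, add_zero]
  | hmem k y hy =>
    by_cases hk : g + k = 0
    · obtain rfl : k = -g := by rw [eq_neg_iff_add_eq_zero, add_comm, hk]
      exact h y hy
    · exact killingForm_eq_zero hk hx hy

/-! ### The zero component of a fine grading and the dichotomy. -/

section FineGrading

variable [IsAlgClosed F] [IsKilling F L]

omit [CharZero F] [IsKilling F L] in
theorem IsFine.lie_eq_zero (hfine : IsFine.{v} ℒ) {s : L} (hs : s ∈ ℒ 0)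
    (hss : IsSemisimpleElement F s) {y : L} (hy : y ∈ ℒ 0) : ⁅s, y⁆ = 0 := by
  obtain ⟨c, hc⟩ := hfine.exists_lie_eq_smul hs hss 0
  have h0 := hc s hs
  rw [lie_self] at h0
  rcases smul_eq_zero.mp h0.symm with rfl | rfl
  · rw [hc y hy, zero_smul]
  · rw [zero_lie]

/-- Engel's theorem: the semisimple part of an element of `L_0` is central in `L_0`, so only the
nilpotent part acts there. -/
theorem IsFine.isNilpotent_zeroComponent (hfine : IsFine.{v} ℒ)
    (hsep : ∀ u : G, u ≠ 0 → ∃ χ : Multiplicative G →* F, χ (.ofAdd u) ≠ 1) :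
    LieRing.IsNilpotent (zeroComponent ℒ) := by
  rw [LieAlgebra.isNilpotent_iff_forall (R := F)]
  rintro ⟨x, hx⟩
  obtain ⟨n, hn0, s, hs0, hn, hs, -, rfl⟩ := exists_homogeneous_jordan_decomposition hsep hx
  have h1 : ad F (zeroComponent ℒ) ⟨n + s, hx⟩ = ad F (zeroComponent ℒ) ⟨n, hn0⟩ := by
    ext ⟨y, hy⟩
    have := hfine.lie_eq_zero hs0 hs hy
    simp [this]
  rw [h1]
  exact LieSubalgebra.isNilpotent_ad_of_isNilpotent_ad _ hn

/-- For the nilpotent algebra `L_0` acting on `L`, the Killing form is a sum over weights of `dim ·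
χ(n) χ(y)`, and every weight vanishes on a nilpotent `n`. -/
theorem IsFine.eq_zero_of_isNilpotentElement (hfine : IsFine.{v} ℒ)
    (hsep : ∀ u : G, u ≠ 0 → ∃ χ : Multiplicative G →* F, χ (.ofAdd u) ≠ 1) {n : L}
    (hn0 : n ∈ ℒ 0) (hn : IsNilpotentElement F n) : n = 0 := by
  have := hfine.isNilpotent_zeroComponent hsep
  refine eq_zero_of_killingForm_eq_zero hn0 fun y hy => ?_
  rw [neg_zero] at hy
  have h1 := LieModule.traceForm_eq_sum_finrank_nsmul_mul F (zeroComponent ℒ) L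
    ⟨n, hn0⟩ ⟨y, hy⟩
  have h2 : killingForm F L n y =
    LieModule.traceForm F (zeroComponent ℒ) L ⟨n, hn0⟩ ⟨y, hy⟩ := rfl
  rw [h2, h1]
  refine Finset.sum_eq_zero fun χ _ => ?_
  have h3 : χ ⟨n, hn0⟩ = 0 := by
    have h4 := χ.hasEigenvalueAt ⟨n, hn0⟩
    have h5 : IsNilpotent (LieModule.toEnd F (zeroComponent ℒ) L ⟨n, hn0⟩) := hn
    exact (h4.isNilpotent_of_isNilpotent h5).eq_zero
  rw [h3, zero_mul, smul_zero]

theorem IsFine.isSemisimpleElement (hfine : IsFine.{v} ℒ)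
    (hsep : ∀ u : G, u ≠ 0 → ∃ χ : Multiplicative G →* F, χ (.ofAdd u) ≠ 1) {x : L}
    (hx : x ∈ ℒ 0) : IsSemisimpleElement F x := by
  obtain ⟨n, hn0, s, hs0, hn, hs, -, rfl⟩ := exists_homogeneous_jordan_decomposition hsep hx
  rwa [hfine.eq_zero_of_isNilpotentElement hsep hn0 hn, zero_add]

omit [IsAlgClosed F] [IsKilling F L] in
/-- An element that is an eigenvector with nonzero eigenvalue of an inner derivation is
nilpotent. -/
theorem isNilpotentElement_of_lie_eq_smul {h x : L} {c : F} (hc : c ≠ 0) (hx : ⁅h, x⁆ = c • x) :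
    IsNilpotentElement F x := by
  by_contra hnil
  set A : End F L := ad F L h
  set B : End F L := ad F L x
  have hAB : A * B - B * A = c • B := by
    rw [← ad_lie_eq, hx, map_smul]
  let T : End F (End F L) := LinearMap.mulLeft F A - LinearMap.mulRight F A
  -- Nonzero powers of `B` would be eigenvectors of `[A, ·]` for the eigenvalues `k c`, infinitely
  -- many in characteristic zero.
  have hT : ∀ k : ℕ, T (B ^ k) = ((k : F) * c) • B ^ k := by
    intro k
    induction k with
    | zero => simp [T]
    | succ k ih =>
      simp only [T, LinearMap.sub_apply, LinearMap.mulLeft_apply, LinearMap.mulRight_apply] at ih ⊢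
      have h1 : A * B ^ (k + 1) - B ^ (k + 1) * A
          = (A * B ^ k - B ^ k * A) * B + B ^ k * (A * B - B * A) := by
        rw [pow_succ]; noncomm_ring
      rw [h1, ih, hAB, smul_mul_assoc, mul_smul_comm, ← pow_succ, ← add_smul]
      congr 1
      push_cast; ring
  have hev : ∀ k : ℕ, T.HasEigenvalue ((k : F) * c) := fun k =>
    End.hasEigenvalue_of_hasEigenvector
      (x := B ^ k) ⟨End.mem_eigenspace_iff.mpr (hT k), fun h0 => hnil ⟨k, h0⟩⟩
  have hinj : Function.Injective (fun k : ℕ => (k : F) * c) := fun k l hkl =>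
    Nat.cast_injective (mul_right_cancel₀ hc hkl)
  exact Set.infinite_of_injective_forall_mem hinj hev T.finite_hasEigenvalue

omit [IsAlgClosed F] [CharZero F] in
/-- If the component of degree zero centralizes the component of degree `g`, then the latter
contains no nonzero nilpotent elements. -/
theorem eq_zero_of_isNilpotentElement_of_lie_eq_zero {g : G}
    (hg : ∀ h ∈ ℒ 0, ∀ x ∈ ℒ g, ⁅h, x⁆ = 0) {n : L} (hng : n ∈ ℒ g)
    (hn : IsNilpotentElement F n) : n = 0 := by
  refine eq_zero_of_killingForm_eq_zero hng fun y hy => ?_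
  have hny0 : ⁅n, y⁆ ∈ ℒ 0 := by
    have := lie_mem hng hy
    rwa [add_neg_cancel] at this
  -- Invariance moves the bracket onto `[h, n] = 0`. Once `n` and `y` commute, `ad n ∘ ad y` is
  -- nilpotent and has trace zero.
  have hny : ⁅n, y⁆ = 0 := by
    refine eq_zero_of_killingForm_eq_zero hny0 fun h hh => ?_
    rw [neg_zero] at hh
    rw [LieModule.traceForm_comm, ← LieModule.traceForm_apply_lie_apply, hg h hh n hng, map_zero,
      LinearMap.zero_apply]
  rw [killingForm_apply_apply]
  exact (LinearMap.isNilpotent_trace_of_isNilpotent ((commute_ad hny).isNilpotent_mul_right hn)).eq_zero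

theorem IsFine.isSemisimpleElement_or_isNilpotentElement (hfine : IsFine.{v} ℒ)
    (hsep : ∀ u : G, u ≠ 0 → ∃ χ : Multiplicative G →* F, χ (.ofAdd u) ≠ 1) {g : G} {x : L}
    (hx : x ∈ ℒ g) : IsSemisimpleElement F x ∨ IsNilpotentElement F x := by
  by_cases hg : ∀ h ∈ ℒ 0, ∀ x ∈ ℒ g, ⁅h, x⁆ = 0
  · left
    obtain ⟨n, hng, s, hsg, hn, hs, -, rfl⟩ := exists_homogeneous_jordan_decomposition hsep hx
    rwa [eq_zero_of_isNilpotentElement_of_lie_eq_zero hg hng hn, zero_add]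
  · right
    push Not at hg
    obtain ⟨h, hh, y, hy, hhy⟩ := hg
    obtain ⟨c, hc⟩ := hfine.exists_lie_eq_smul hh (hfine.isSemisimpleElement hsep hh) g
    refine isNilpotentElement_of_lie_eq_smul (c := c) ?_ (hc x hx)
    rintro rfl
    exact hhy (by rw [hc y hy, zero_smul])

end FineGrading

end Graded

end LieGrading

namespace LieGrading

open Module LieAlgebra

/-! ### The universal group of a grading. -/

section UniversalGroup

variable {F L G : Type*} [Field F] [LieRing L] [LieAlgebra F L] [AddCommGroup G]

/-- A function on the grading group with values in an abelian group that is additive along nonzero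
brackets. -/
def IsAdditiveOnBrackets (ℒ : G → Submodule F L) {A : Type*} [AddCommGroup A] (c : G → A) : Prop :=
  ∀ g h, ∀ x ∈ ℒ g, ∀ y ∈ ℒ h, ⁅x, y⁆ ≠ 0 → c (g + h) = c g + c h

variable (ℒ : G → Submodule F L)

/-- The relations `g + h = k` between elements of the support imposed by nonzero brackets. -/
noncomputable def bracketRelations : AddSubgroup ({g : G // ℒ g ≠ ⊥} →₀ ℤ) :=
  AddSubgroup.closure {r | ∃ g h k : {g : G // ℒ g ≠ ⊥}, (k : G) = g + h ∧
    (∃ x ∈ ℒ g, ∃ y ∈ ℒ h, ⁅x, y⁆ ≠ 0) ∧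
    r = Finsupp.single k 1 - (Finsupp.single g 1 + Finsupp.single h 1)}

/-- The universal group of a grading: the abelian group generated by the support, subject to the
relations imposed by nonzero brackets. -/
abbrev UniversalGroup : Type _ := ({g : G // ℒ g ≠ ⊥} →₀ ℤ) ⧸ bracketRelations ℒ

open Classical in
/-- The class in the universal group of an element of the support. -/
noncomputable def universalDegree (g : G) : UniversalGroup ℒ :=
  -- The value off the support is immaterial, as the component there is zero.
  if hg : ℒ g ≠ ⊥ then QuotientAddGroup.mk (Finsupp.single ⟨g, hg⟩ 1) else 0

variable {ℒ}

theorem universalDegree_of_ne_bot {g : G} (hg : ℒ g ≠ ⊥) :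
    universalDegree ℒ g = QuotientAddGroup.mk (Finsupp.single ⟨g, hg⟩ 1) := dif_pos hg

omit [AddCommGroup G] in
theorem ne_bot_of_mem {g : G} {x : L} (hx : x ∈ ℒ g) (h0 : x ≠ 0) : ℒ g ≠ ⊥ := fun h => by
  rw [h, Submodule.mem_bot] at hx; exact h0 hx

theorem isAdditiveOnBrackets_universalDegree [DecidableEq G] [GradedLieAlgebra ℒ] :
    IsAdditiveOnBrackets ℒ (universalDegree ℒ) := by
  intro g h x hx y hy hxy
  have hg : ℒ g ≠ ⊥ := ne_bot_of_mem hx (by rintro rfl; simp at hxy)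
  have hh : ℒ h ≠ ⊥ := ne_bot_of_mem hy (by rintro rfl; simp at hxy)
  have hgh : ℒ (g + h) ≠ ⊥ := ne_bot_of_mem (lie_mem hx hy) hxy
  rw [universalDegree_of_ne_bot hg, universalDegree_of_ne_bot hh, universalDegree_of_ne_bot hgh,
    ← QuotientAddGroup.mk_add, ← sub_eq_zero, ← QuotientAddGroup.mk_sub,
    QuotientAddGroup.eq_zero_iff]
  exact AddSubgroup.subset_closure ⟨⟨g, hg⟩, ⟨h, hh⟩, ⟨g + h, hgh⟩, rfl, ⟨x, hx, y, hy, hxy⟩, rfl⟩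

/-- The universal property of the universal group. -/
theorem IsAdditiveOnBrackets.exists_hom {A : Type*} [AddCommGroup A] {c : G → A}
    (hc : IsAdditiveOnBrackets ℒ c) :
    ∃ f : UniversalGroup ℒ →+ A, ∀ g, ℒ g ≠ ⊥ → f (universalDegree ℒ g) = c g := by
  let f₀ : ({g : G // ℒ g ≠ ⊥} →₀ ℤ) →+ A :=
    (Finsupp.linearCombination ℤ fun g : {g : G // ℒ g ≠ ⊥} => c g).toAddMonoidHom
  have hf₀ : ∀ g, f₀ (Finsupp.single g 1) = c g := fun g => by simp [f₀]
  have hle : bracketRelations ℒ ≤ f₀.ker := by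
    rw [bracketRelations, AddSubgroup.closure_le]
    rintro _ ⟨g, h, k, hk, ⟨x, hx, y, hy, hxy⟩, rfl⟩
    rw [SetLike.mem_coe, AddMonoidHom.mem_ker, map_sub, map_add, hf₀, hf₀, hf₀, hk,
      hc g h x hx y hy hxy, sub_self]
  refine ⟨QuotientAddGroup.lift _ f₀ hle, fun g hg => ?_⟩
  rw [universalDegree_of_ne_bot hg]
  exact hf₀ ⟨g, hg⟩

theorem universalGroup_induction (N : AddSubgroup (UniversalGroup ℒ))
    (hN : ∀ g, ℒ g ≠ ⊥ → universalDegree ℒ g ∈ N) (u : UniversalGroup ℒ) : u ∈ N := by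
  obtain ⟨a, rfl⟩ := QuotientAddGroup.mk_surjective u
  induction a using Finsupp.induction_linear with
  | zero => exact N.zero_mem
  | add a b ha hb => exact N.add_mem ha hb
  | single g k =>
    have h1 : Finsupp.single g k = k • Finsupp.single g (1 : ℤ) := by simp
    rw [h1, QuotientAddGroup.mk_zsmul]
    have h2 := hN g g.2
    rw [universalDegree_of_ne_bot g.2] at h2
    exact N.zsmul_mem h2 k

theorem universalGroup_fg [FiniteDimensional F L] [DecidableEq G] [GradedLieAlgebra ℒ] :
    AddGroup.FG (UniversalGroup ℒ) := by
  have : Finite {g : G // ℒ g ≠ ⊥} := (finite_support ℒ).to_subtype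
  have : AddGroup.FG ({g : G // ℒ g ≠ ⊥} →₀ ℤ) := Module.Finite.iff_addGroup_fg.mp inferInstance
  exact QuotientAddGroup.fg _

end UniversalGroup

/-! ### The zero component as the diagonal derivations. -/

section Torus

variable {F L G : Type*} [Field F] [LieRing L] [LieAlgebra F L] [AddCommGroup G] [DecidableEq G]
  {ℒ : G → Submodule F L} [GradedLieAlgebra ℒ]

theorem scale_congr {c c' : G → F} (h : ∀ g, ℒ g ≠ ⊥ → c g = c' g) : scale ℒ c = scale ℒ c' :=
  (eq_scale fun g x hx => by
    rw [scale_apply c' hx]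
    by_cases hx0 : x = 0
    · simp [hx0]
    · rw [h g (ne_bot_of_mem hx hx0)]).symm

variable (ℒ) in
/-- The diagonal endomorphism attached to an additive function on the universal group. -/
noncomputable def scaleHom : (UniversalGroup ℒ →+ F) →ₗ[F] End F L where
  toFun f := scale ℒ fun g => f (universalDegree ℒ g)
  map_add' f f' := (eq_scale fun g x hx => by
    rw [LinearMap.add_apply, scale_apply _ hx, scale_apply _ hx, AddMonoidHom.add_apply,
      add_smul]).symm
  map_smul' a f := (eq_scale fun g x hx => by
    rw [LinearMap.smul_apply, scale_apply _ hx, RingHom.id_apply, AddMonoidHom.smul_apply,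
      smul_eq_mul, mul_smul]).symm

theorem scaleHom_apply (f : UniversalGroup ℒ →+ F) {g : G} {x : L} (hx : x ∈ ℒ g) :
    scaleHom ℒ f x = f (universalDegree ℒ g) • x := scale_apply _ hx

theorem scaleHom_injective : Function.Injective (scaleHom ℒ) := by
  rw [injective_iff_map_eq_zero]
  intro f hf
  refine AddMonoidHom.ext fun u => ?_
  refine universalGroup_induction f.ker (fun g hg => ?_) u
  obtain ⟨x, hx, hx0⟩ := Submodule.exists_mem_ne_zero_of_ne_bot hg
  have h := scaleHom_apply f hx
  rw [hf, LinearMap.zero_apply] at h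
  exact (smul_eq_zero.mp h.symm).resolve_right hx0

variable [FiniteDimensional F L]

/-- An element whose adjoint endomorphism preserves all components has degree zero. -/
theorem mem_zero_of_forall_lie_mem [CharZero F] [IsKilling F L]
    (hsep : ∀ u : G, u ≠ 0 → ∃ χ : Multiplicative G →* F, χ (.ofAdd u) ≠ 1) {h : L}
    (hh : ∀ g, ∀ x ∈ ℒ g, ⁅h, x⁆ ∈ ℒ g) : h ∈ ℒ 0 := by
  refine mem_of_forall_character hsep fun χ => ?_
  have h0 : ∀ g : G, χ (.ofAdd g) ≠ 0 := fun g =>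
    ((Group.isUnit (Multiplicative.ofAdd g)).map χ).ne_zero
  let e : L ≃ₗ⁅F⁆ L := scaleEquiv (ℒ := ℒ) (fun g => χ (.ofAdd g)) h0
    (fun a b _ _ _ _ _ => by rw [ofAdd_add, map_mul])
  have he : ∀ y, e y = scale ℒ (fun g => χ (.ofAdd g)) y := fun _ => rfl
  rw [ofAdd_zero, map_one, one_smul, ← he]
  apply ad_injective (F := F)
  refine linearMap_ext (ℒ := ℒ) fun g x hx => ?_
  have h1 : e ⁅h, x⁆ = ⁅e h, e x⁆ := e.map_lie h x
  rw [he ⁅h, x⁆, he x, scale_apply _ hx, scale_apply _ (hh g x hx), lie_smul] at h1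
  -- The automorphism `e` commutes with `ad h`, so `h` and `e h` have the same adjoint action.
  exact (smul_right_injective L (h0 g) h1).symm

/-- The scalars by which an element of `L_0` acts are additive along brackets, so they factor
through the universal group. Conversely, a diagonal derivation is inner, and an element whose `ad`
preserves all components has degree zero. -/
theorem IsFine.map_ad_eq_range [IsAlgClosed F] [CharZero F] [IsKilling F L]
    (hfine : IsFine.{v} ℒ)
    (hsep : ∀ u : G, u ≠ 0 → ∃ χ : Multiplicative G →* F, χ (.ofAdd u) ≠ 1) :
    (ℒ 0).map (ad F L : L →ₗ[F] End F L) = LinearMap.range (scaleHom ℒ) := by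
  apply le_antisymm
  · rintro _ ⟨h, hh, rfl⟩
    choose c hc using hfine.exists_lie_eq_smul hh (hfine.isSemisimpleElement hsep hh)
    have hadd : IsAdditiveOnBrackets ℒ c := by
      intro g k x hx y hy hxy
      have h1 := hc _ _ (lie_mem hx hy)
      rw [leibniz_lie, hc g x hx, hc k y hy, smul_lie, lie_smul, ← add_smul] at h1
      exact (smul_left_injective F hxy h1).symm
    obtain ⟨f, hf⟩ := hadd.exists_hom
    refine ⟨f, ?_⟩
    refine (scale_congr hf).trans (eq_scale fun g x hx => ?_).symm
    exact hc g x hx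
  · rintro _ ⟨f, rfl⟩
    let D : LieDerivation F L L := scaleDerivation (ℒ := ℒ) (fun g => f (universalDegree ℒ g))
      (fun g h x hx y hy hxy => by
        rw [isAdditiveOnBrackets_universalDegree g h x hx y hy hxy, map_add])
    obtain ⟨h, hD⟩ := LieDerivation.IsKilling.exists_eq_ad D
    have hh : ∀ y, ⁅h, y⁆ = scaleHom ℒ f y := fun y =>
      (LieDerivation.ad_apply_apply F L h y).symm.trans (DFunLike.congr_fun hD y)
    refine ⟨h, mem_zero_of_forall_lie_mem hsep fun g x hx => ?_, ?_⟩
    · rw [hh, scaleHom_apply f hx]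
      exact Submodule.smul_mem _ _ hx
    · ext y
      exact hh y

theorem IsFine.finrank_zeroComponent [IsAlgClosed F] [CharZero F] [IsKilling F L]
    (hfine : IsFine.{v} ℒ)
    (hsep : ∀ u : G, u ≠ 0 → ∃ χ : Multiplicative G →* F, χ (.ofAdd u) ≠ 1) :
    finrank F (zeroComponent ℒ) = finrank F (UniversalGroup ℒ →+ F) := by
  rw [← LinearMap.finrank_range_of_inj (scaleHom_injective (ℒ := ℒ)),
    ← hfine.map_ad_eq_range hsep]
  exact (Submodule.equivMapOfInjective (ad F L : L →ₗ[F] End F L)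
    ad_injective (ℒ 0)).finrank_eq

end Torus

/-! ### The coordinate ring of the quasitorus. -/

section Quasitorus

variable {F L G : Type*} [Field F] [LieRing L] [LieAlgebra F L] [AddCommGroup G] [DecidableEq G]
  {ℒ : G → Submodule F L} [GradedLieAlgebra ℒ]

variable (ℒ) in
/-- The diagonal endomorphism attached to a character of the universal group. -/
noncomputable def scaleCharacter (χ : Multiplicative (UniversalGroup ℒ) →* F) : End F L :=
  scale ℒ fun g => χ (.ofAdd (universalDegree ℒ g))

/-- The automorphism attached to a character of the universal group. -/
noncomputable def scaleCharacterEquiv (χ : Multiplicative (UniversalGroup ℒ) →* F) : L ≃ₗ⁅F⁆ L :=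
  scaleEquiv (ℒ := ℒ) (fun g => χ (.ofAdd (universalDegree ℒ g)))
    (fun g => ((Group.isUnit (Multiplicative.ofAdd (universalDegree ℒ g))).map χ).ne_zero)
    (fun g h x hx y hy hxy => by
      rw [isAdditiveOnBrackets_universalDegree g h x hx y hy hxy, ofAdd_add, map_mul])

theorem scaleCharacterEquiv_apply (χ : Multiplicative (UniversalGroup ℒ) →* F) (x : L) :
    scaleCharacterEquiv χ x = scaleCharacter ℒ χ x := rfl

/-- The quasitorus is the group of characters of the universal group. -/
theorem quasitorus_eq_range : quasitorus ℒ = Set.range (scaleCharacter ℒ) := by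
  classical
  ext φ
  constructor
  · rintro ⟨f, hfφ, hf⟩
    choose c hc using hf
    have hc0 : ∀ g, ℒ g ≠ ⊥ → c g ≠ 0 := by
      intro g hg h0
      obtain ⟨x, hx, hx0⟩ := Submodule.exists_mem_ne_zero_of_ne_bot hg
      have h1 := hc g x hx
      rw [h0, zero_smul] at h1
      exact hx0 (f.injective (h1.trans (map_zero f).symm))
    -- Off the support `c` is arbitrary and may be zero, hence the default.
    let d : G → Additive Fˣ := fun g =>
      if hg : ℒ g ≠ ⊥ then Additive.ofMul (Units.mk0 (c g) (hc0 g hg)) else 0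
    have hd : ∀ g, ℒ g ≠ ⊥ → ((d g).toMul : F) = c g := fun g hg => by simp [d, hg]
    have hadd : IsAdditiveOnBrackets ℒ d := by
      intro g h x hx y hy hxy
      have hg : ℒ g ≠ ⊥ := ne_bot_of_mem hx (by rintro rfl; simp at hxy)
      have hh : ℒ h ≠ ⊥ := ne_bot_of_mem hy (by rintro rfl; simp at hxy)
      have hgh : ℒ (g + h) ≠ ⊥ := ne_bot_of_mem (lie_mem hx hy) hxy
      have h1 := hc _ _ (lie_mem hx hy)
      rw [LieEquiv.map_lie, hc g x hx, hc h y hy, smul_lie, lie_smul, smul_smul] at h1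
      apply Additive.toMul.injective
      apply Units.ext
      rw [toMul_add, Units.val_mul, hd _ hg, hd _ hh, hd _ hgh]
      exact (smul_left_injective F hxy h1).symm
    obtain ⟨ψ, hψ⟩ := hadd.exists_hom
    refine ⟨AddCommGroup.unitsCharacter ψ, ?_⟩
    have h1 : scaleCharacter ℒ (AddCommGroup.unitsCharacter ψ) = scale ℒ c :=
      scale_congr fun g hg => by
        rw [AddCommGroup.unitsCharacter_apply, hψ g hg, hd g hg]
    rw [h1]
    refine (eq_scale fun g x hx => ?_).symm
    rw [← hfφ, hc g x hx]
  · rintro ⟨χ, rfl⟩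
    exact ⟨scaleCharacterEquiv χ, fun x => scaleCharacterEquiv_apply χ x,
      fun g => ⟨χ (.ofAdd (universalDegree ℒ g)), fun x hx => scale_apply _ hx⟩⟩

variable [FiniteDimensional F L]

/-- Automorphisms preserve the Killing form, which pairs `L_g` with `L_{-g}`; so every character
takes inverse values on their degrees. This puts inverses into the image of `coordinateHom` without
inverting the determinant. -/
theorem universalDegree_neg [IsKilling F L]
    (hsep : ∀ u : UniversalGroup ℒ, u ≠ 0 →
      ∃ χ : Multiplicative (UniversalGroup ℒ) →* F, χ (.ofAdd u) ≠ 1)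
    {g : G} (hg : ℒ g ≠ ⊥) :
    ℒ (-g) ≠ ⊥ ∧ universalDegree ℒ (-g) = -universalDegree ℒ g := by
  obtain ⟨x, hx, hx0⟩ := Submodule.exists_mem_ne_zero_of_ne_bot hg
  obtain ⟨y, hy, hxy⟩ : ∃ y ∈ ℒ (-g), killingForm F L x y ≠ 0 := by
    by_contra! h
    exact hx0 (eq_zero_of_killingForm_eq_zero hx h)
  refine ⟨ne_bot_of_mem hy (by rintro rfl; simp at hxy), ?_⟩
  rw [eq_neg_iff_add_eq_zero]
  by_contra hne
  obtain ⟨χ, hχ⟩ := hsep _ hne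
  apply hχ
  have h1 := LieAlgebra.killingForm_of_equiv_apply (scaleCharacterEquiv χ) x y
  rw [scaleCharacterEquiv_apply, scaleCharacterEquiv_apply, scaleCharacter, scale_apply _ hx,
    scale_apply _ hy] at h1
  simp only [map_smul, LinearMap.smul_apply, smul_eq_mul, ← mul_assoc] at h1
  rw [ofAdd_add, map_mul]
  exact mul_right_cancel₀ hxy (by rw [h1, one_mul])

/-- Each `scale ℒ (Pi.single g 1)` is the projection onto `L_g`; its matrix entries are the
coefficients in `coordinateHom`. -/
theorem scale_eq_sum (c : G → F) :
    scale ℒ c = ∑ g ∈ (finite_support ℒ).toFinset, c g • scale ℒ (Pi.single g 1) := by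
  refine (eq_scale fun g x hx => ?_).symm
  rw [LinearMap.sum_apply]
  simp only [LinearMap.smul_apply, scale_apply _ hx]
  by_cases hg : ℒ g = ⊥
  · rw [hg, Submodule.mem_bot] at hx
    simp [hx]
  · rw [Finset.sum_eq_single g]
    · simp
    · intro k _ hk
      simp [Pi.single_eq_of_ne' hk]
    · intro h
      simp [hg] at h

variable (ℒ) in
/-- Restriction of the matrix entries to the quasitorus, with values in the group algebra of the
universal group. -/
noncomputable def coordinateHom :
    MvPolynomial (Fin (finrank F L) × Fin (finrank F L)) F →ₐ[F]
      AddMonoidAlgebra F (UniversalGroup ℒ) :=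
  MvPolynomial.aeval fun p => ∑ g ∈ (finite_support ℒ).toFinset,
    AddMonoidAlgebra.single (universalDegree ℒ g)
      (LinearMap.toMatrix (finBasis F L) (finBasis F L) (scale ℒ (Pi.single g 1)) p.1 p.2)

theorem lift_coordinateHom (χ : Multiplicative (UniversalGroup ℒ) →* F)
    (p : MvPolynomial (Fin (finrank F L) × Fin (finrank F L)) F) :
    AddMonoidAlgebra.lift F F _ χ (coordinateHom ℒ p) =
      MvPolynomial.aeval (fun p : Fin (finrank F L) × Fin (finrank F L) =>
        LinearMap.toMatrix (finBasis F L) (finBasis F L) (scaleCharacter ℒ χ) p.1 p.2) p := by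
  have : (AddMonoidAlgebra.lift F F _ χ).comp (coordinateHom ℒ) =
      MvPolynomial.aeval (fun p : Fin (finrank F L) × Fin (finrank F L) =>
        LinearMap.toMatrix (finBasis F L) (finBasis F L) (scaleCharacter ℒ χ) p.1 p.2) := by
    apply MvPolynomial.algHom_ext
    intro p
    simp only [AlgHom.comp_apply, coordinateHom, MvPolynomial.aeval_X, map_sum,
      AddMonoidAlgebra.lift_single]
    rw [scaleCharacter, scale_eq_sum, map_sum, Matrix.sum_apply]
    refine Finset.sum_congr rfl fun g _ => ?_
    rw [map_smul, Matrix.smul_apply, smul_eq_mul, smul_eq_mul, mul_comm]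
  exact DFunLike.congr_fun this p

/-- Points of the quasitorus are characters, and characters separate elements of the group algebra.
-/
theorem ker_coordinateHom
    (hsep : ∀ u : UniversalGroup ℒ, u ≠ 0 →
      ∃ χ : Multiplicative (UniversalGroup ℒ) →* F, χ (.ofAdd u) ≠ 1) :
    RingHom.ker (coordinateHom ℒ) = MvPolynomial.vanishingIdeal F
      ((fun (φ : End F L) (p : Fin (finrank F L) × Fin (finrank F L)) =>
        LinearMap.toMatrix (finBasis F L) (finBasis F L) φ p.1 p.2) '' quasitorus ℒ) := by
  ext p
  rw [RingHom.mem_ker, MvPolynomial.mem_vanishingIdeal_iff, quasitorus_eq_range]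
  constructor
  · rintro hp _ ⟨_, ⟨χ, rfl⟩, rfl⟩
    rw [← lift_coordinateHom, hp, map_zero]
  · intro hp
    refine AddMonoidAlgebra.eq_zero_of_forall_lift_eq_zero hsep _ fun χ => ?_
    rw [lift_coordinateHom]
    exact hp _ ⟨_, ⟨χ, rfl⟩, rfl⟩

theorem single_universalDegree_mem_range {g : G} (hg : ℒ g ≠ ⊥) :
    AddMonoidAlgebra.single (universalDegree ℒ g) (1 : F) ∈ (coordinateHom ℒ).range := by
  obtain ⟨x, hx, hx0⟩ := Submodule.exists_mem_ne_zero_of_ne_bot hg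
  set b := finBasis F L
  obtain ⟨i, hi⟩ : ∃ i, b.repr x i ≠ 0 := by
    by_contra! h
    exact hx0 (b.repr.map_eq_zero_iff.mp (Finsupp.ext h))
  -- At `φ` in the quasitorus this polynomial is the `i`-th coordinate of `φ x` over that of `x`:
  -- the eigenvalue of `φ` on `L_g`.
  refine ⟨∑ j, MvPolynomial.C ((b.repr x i)⁻¹ * b.repr x j) * MvPolynomial.X (i, j), ?_⟩
  have hmat : ∀ k : G, ∑ j, LinearMap.toMatrix b b (scale ℒ (Pi.single k 1)) i j * b.repr x j =
      (Pi.single k (1 : F) : G → F) g * b.repr x i := by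
    intro k
    have h1 := congrFun (LinearMap.toMatrix_mulVec_repr b b (scale ℒ (Pi.single k 1)) x) i
    rw [scale_apply _ hx, map_smul] at h1
    exact h1
  have hsingle : ∀ (k : G) (r : F), AddMonoidAlgebra.single (universalDegree ℒ k) r =
      r • AddMonoidAlgebra.single (universalDegree ℒ k) (1 : F) := fun k r => by simp
  have hX : ∀ (r : F) j, coordinateHom ℒ (MvPolynomial.C r * MvPolynomial.X (i, j)) =
      ∑ k ∈ (finite_support ℒ).toFinset, r • AddMonoidAlgebra.single (universalDegree ℒ k)
        (LinearMap.toMatrix b b (scale ℒ (Pi.single k 1)) i j) := by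
    intro r j
    rw [map_mul, ← MvPolynomial.algebraMap_eq, AlgHom.commutes, ← Algebra.smul_def, coordinateHom,
      MvPolynomial.aeval_X, Finset.smul_sum]
  change coordinateHom ℒ _ = _
  rw [map_sum, Finset.sum_congr rfl fun j _ => hX _ j, Finset.sum_comm]
  have hterm : ∀ k : G, ∑ j, ((b.repr x i)⁻¹ * b.repr x j) •
      AddMonoidAlgebra.single (universalDegree ℒ k)
        (LinearMap.toMatrix b b (scale ℒ (Pi.single k 1)) i j) =
      (Pi.single k (1 : F) : G → F) g • AddMonoidAlgebra.single (universalDegree ℒ k) (1 : F) := by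
    intro k
    simp only [hsingle k (LinearMap.toMatrix b b (scale ℒ (Pi.single k 1)) i _), smul_smul]
    rw [← Finset.sum_smul]
    congr 1
    have h1 : ∑ j, (b.repr x i)⁻¹ * b.repr x j *
        LinearMap.toMatrix b b (scale ℒ (Pi.single k 1)) i j =
        (b.repr x i)⁻¹ * ∑ j, LinearMap.toMatrix b b (scale ℒ (Pi.single k 1)) i j *
          b.repr x j := by
      rw [Finset.mul_sum]
      exact Finset.sum_congr rfl fun j _ => by ring
    rw [h1, hmat, mul_comm, mul_assoc, mul_inv_cancel₀ hi, mul_one]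
  rw [Finset.sum_congr rfl fun k _ => hterm k, Finset.sum_eq_single g]
  · simp
  · intro k _ hk
    simp [Pi.single_eq_of_ne' hk]
  · intro h
    simp [hg] at h

theorem coordinateHom_surjective [IsKilling F L]
    (hsep : ∀ u : UniversalGroup ℒ, u ≠ 0 →
      ∃ χ : Multiplicative (UniversalGroup ℒ) →* F, χ (.ofAdd u) ≠ 1) :
    Function.Surjective (coordinateHom ℒ) := by
  have hadd : ∀ u w : UniversalGroup ℒ,
      AddMonoidAlgebra.single u (1 : F) ∈ (coordinateHom ℒ).range →
      AddMonoidAlgebra.single w (1 : F) ∈ (coordinateHom ℒ).range →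
      AddMonoidAlgebra.single (u + w) (1 : F) ∈ (coordinateHom ℒ).range := fun u w hu hw => by
    have := mul_mem hu hw
    rwa [AddMonoidAlgebra.single_mul_single, mul_one] at this
  let N : AddSubgroup (UniversalGroup ℒ) :=
    { carrier := {u | AddMonoidAlgebra.single u (1 : F) ∈ (coordinateHom ℒ).range ∧
        AddMonoidAlgebra.single (-u) (1 : F) ∈ (coordinateHom ℒ).range}
      zero_mem' := by
        have h1 : AddMonoidAlgebra.single (0 : UniversalGroup ℒ) (1 : F) ∈
          (coordinateHom ℒ).range := one_mem _
        exact ⟨h1, by rwa [neg_zero]⟩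
      add_mem' := fun hu hw => ⟨hadd _ _ hu.1 hw.1, by
        rw [neg_add]; exact hadd _ _ hu.2 hw.2⟩
      neg_mem' := fun hu => ⟨hu.2, by rw [neg_neg]; exact hu.1⟩ }
  have hN : ∀ u, u ∈ N := universalGroup_induction N fun g hg => by
    obtain ⟨hg', hdeg⟩ := universalDegree_neg hsep hg
    refine ⟨single_universalDegree_mem_range hg, ?_⟩
    rw [← hdeg]
    exact single_universalDegree_mem_range hg'
  intro p
  change p ∈ (coordinateHom ℒ).range
  induction p using AddMonoidAlgebra.induction_on with
  | of u => exact (hN u).1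
  | add p q hp hq => exact add_mem hp hq
  | smul r p hp => exact Subalgebra.smul_mem _ hp r

theorem algebraicDim_quasitorus [IsKilling F L] [IsAlgClosed F] [CharZero F] :
    algebraicDim (quasitorus ℒ) = (finrank F (UniversalGroup ℒ →+ F) : WithBot ℕ∞) := by
  have := universalGroup_fg (ℒ := ℒ)
  have hsep := AddCommGroup.exists_character_ne_one F (UniversalGroup ℒ)
  rw [← AddCommGroup.ringKrullDim_addMonoidAlgebra F (UniversalGroup ℒ)]
  exact ringKrullDim_eq_of_ringEquiv ((Ideal.quotEquivOfEq (ker_coordinateHom hsep).symm).trans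
    (RingHom.quotientKerEquivOfSurjective (f := (coordinateHom ℒ).toRingHom)
      (coordinateHom_surjective hsep)))

end Quasitorus

end LieGrading

theorem mainTheorem7 {F L G : Type*} [Field F] [IsAlgClosed F] [CharZero F]
    [LieRing L] [LieAlgebra F L] [FiniteDimensional F L] [LieAlgebra.IsSimple F L]
    [AddCommGroup G] [DecidableEq G] (ℒ : G → Submodule F L) [GradedLieAlgebra ℒ]
    (hgen : LieGrading.GeneratedBySupport ℒ) (hfine : LieGrading.IsFine.{v} ℒ) :
    (∀ (g : G), ∀ x ∈ ℒ g,
      LieGrading.IsSemisimpleElement F x ∨ LieGrading.IsNilpotentElement F x) ∧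
    IsLieAbelian (LieGrading.zeroComponent ℒ) ∧
    LieGrading.IsToral (LieGrading.zeroComponent ℒ) ∧
    LieGrading.algebraicDim (LieGrading.quasitorus ℒ) =
      (Module.finrank F (LieGrading.zeroComponent ℒ) : WithBot ℕ∞) := by
  have := LieGrading.fg_of_generatedBySupport hgen
  have hsep := AddCommGroup.exists_character_ne_one F G
  refine ⟨fun g x hx => hfine.isSemisimpleElement_or_isNilpotentElement hsep hx, ⟨?_⟩,
    fun x hx => hfine.isSemisimpleElement hsep hx, ?_⟩
  · rintro ⟨x, hx⟩ ⟨y, hy⟩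
    exact Subtype.ext (hfine.lie_eq_zero hx (hfine.isSemisimpleElement hsep hx) hy)
  · rw [LieGrading.algebraicDim_quasitorus, hfine.finrank_zeroComponent hsep]
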